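/- For a real number $\xi$ let $\mu(\xi)\in[1,\infty]$ denote its irrationality exponent, that is, the supremum of the real numbers $\tau$ such that $|\xi-p/q|\le q^{-\tau}$ holds for infinitely many rational numbers $p/q$ (written in lowest terms with $q\ge 1$). For real $2\le\lambda\le\mu$ put $\mathscr{W}_{\lambda;\mu}=\{\xi\in\mathbb{R}:\lambda\le\mu(\xi)\le\mu\}$, let $\mathscr{W}_{\lambda;\mu}^{n}\subseteq\mathbb{R}^n$ be its $n$-fold Cartesian product with itself, and let $\dim$ denote Hausdorff dimension. Let $n\ge 2$ be an integer and let $\lambda\le\mu$ be real numbers with $$\lambda>\frac{2n}{n-1}\qquad\text{and}\qquad \mu>\frac{\lambda^{n-1}+\lambda-1}{\lambda-1}.$$ Then $$\dim\big(\mathscr{W}_{\lambda;\mu}^{n}\big)>n\cdot\dim\big(\mathscr{W}_{\lambda;\mu}\big).$$ That is, for these sets the product inequality $\dim(A_1\times\cdots\times A_n)\ge\dim A_1+\cdots+\dim A_n$ is strict. -/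

import Mathlib

open MeasureTheory
open scoped ENNReal

noncomputable section

/-- The irrationality exponent of `ξ`: the supremum, in the extended reals, of the real numbers `τ`
for which `|ξ - p/q| ≤ q ^ (-τ)` has infinitely many solutions in rational numbers `p/q`.
A rational number is counted once, and `q` is its denominator in lowest terms. -/
def irrationalityExponent (ξ : ℝ) : EReal :=
  sSup ((fun τ : ℝ => (τ : EReal)) ''
    {τ : ℝ | {r : ℚ | |ξ - (r : ℝ)| ≤ (r.den : ℝ) ^ (-τ)}.Infinite})

/-- The set of real numbers whose irrationality exponent lies in `[lam, mu]`. -/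
def exponentSet (lam mu : EReal) : Set ℝ :=
  {ξ : ℝ | lam ≤ irrationalityExponent ξ ∧ irrationalityExponent ξ ≤ mu}

/-- The `n`-fold Cartesian product of `A ⊆ ℝ` with itself, as a subset of Euclidean `n`-space. -/
def cartesianPower (n : ℕ) (A : Set ℝ) : Set (EuclideanSpace ℝ (Fin n)) :=
  {x | ∀ i, x i ∈ A}

end

/-! Covering by balls around fractions gives `dimH (exponentSet lam mu) ≤ 2 / lam`, so `n` copies
contribute at most `2n / lam < n - 1`. It remains to see that the power has dimension at least `n -
1`. The Lipschitz map sending `x` to its differences with the coordinate `x 0` maps the power onto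
almost all of `ℝ^(n-1)`: for almost every `w`, some common translate of `0, w₁, …` has all
coordinates in the exponent set (`ae_exists_forall_sub_mem_exponentSet`).

The translate comes from nested intervals (`exists_forall_odd_approx`). At scales `2 ^ m k` with `m
(k + 1) ≈ lam * m k`, the coordinates take turns being at distance about `2 ^ (-lam * m k)` from a
reduced fraction, so each exponent is at least `lam`. Conversely, a coordinate is kept away from any
other fraction by its own approximants, and at the remaining scales by those of another coordinate,
since the difference of the two is generic (`ae_forall_abs_sub_fraction_ge`). Balancing the scales
(`exists_forall_ge_exists_index`) keeps the exponents at most `mu`. -/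

/-! ### Upper bound for the dimension of one factor. -/

open Filter Topology Set in
/-- The Hausdorff–Cantelli lemma. -/
theorem hausdorffMeasure_setOf_infinite_eq_zero {X ι : Type*} [EMetricSpace X] [MeasurableSpace X]
    [BorelSpace X] [Countable ι] (B : ι → Set X) {d : ℝ} (hd : 0 < d)
    (h : ∑' i, Metric.ediam (B i) ^ d ≠ ∞) :
    Measure.hausdorffMeasure d {x | {i | x ∈ B i}.Infinite} = 0 := by
  have htail := ENNReal.tendsto_tsum_compl_atTop_zero h
  -- The sets with index outside a finite `F` cover the limsup set; the tail sum controls both their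
  -- total and, through its `d`-th root, their diameters.
  have key := Measure.hausdorffMeasure_le_liminf_tsum d {x | {i | x ∈ B i}.Infinite}
    (l := (atTop : Filter (Finset ι))) (ι := fun F => {i // i ∉ F})
    (fun F => (∑' i : {i // i ∉ F}, Metric.ediam (B i) ^ d) ^ d⁻¹)
    (by
      have := (ENNReal.continuous_rpow_const (y := d⁻¹)).tendsto 0 |>.comp htail
      rwa [ENNReal.zero_rpow_of_pos (inv_pos.2 hd)] at this)
    (fun F i => B i)
    (Eventually.of_forall fun F i => by
      rw [ENNReal.le_rpow_inv_iff hd]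
      exact ENNReal.le_tsum (f := fun i : {i // i ∉ F} => Metric.ediam (B i) ^ d) i)
    (Eventually.of_forall fun F x hx => by
      obtain ⟨i, hi, hiF⟩ := hx.exists_notMem_finset F
      exact mem_iUnion.2 ⟨⟨i, hiF⟩, hi⟩)
  rw [htail.liminf_eq] at key
  exact le_antisymm key bot_le

theorem tsum_int_abs_le (N : ℕ) (c : ℝ≥0∞) :
    ∑' p : ℤ, (if |p| ≤ (N : ℤ) then c else 0) = (2 * N + 1) * c := by
  rw [tsum_eq_sum (s := Finset.Icc (-(N : ℤ)) N)]
  · rw [Finset.sum_congr rfl (g := fun _ => c)]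
    · rw [Finset.sum_const, Int.card_Icc, nsmul_eq_mul,
        show ((N : ℤ) + 1 - -(N : ℤ)).toNat = 2 * N + 1 by omega]
      push_cast; rfl
    · intro p hp
      rw [if_pos]
      rw [Finset.mem_Icc] at hp
      exact abs_le.2 hp
  · intro p hp
    rw [if_neg]
    rwa [Finset.mem_Icc, ← abs_le] at hp

theorem tsum_ofReal_rpow_neg_ne_top {s : ℝ} (hs : 1 < s) :
    ∑' q : ℕ, ENNReal.ofReal ((q : ℝ) ^ (-s)) ≠ ∞ :=
  (Real.summable_nat_rpow.2 (by linarith)).tsum_ofReal_ne_top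

theorem tsum_fractions_ne_top (K : ℕ) {s : ℝ} (hs : 2 < s) :
    ∑' z : ℕ × ℤ, (if |z.2| ≤ ((K * z.1 : ℕ) : ℤ) then ENNReal.ofReal ((z.1 : ℝ) ^ (-s)) else 0)
      ≠ ∞ := by
  rw [ENNReal.tsum_prod (f := fun (q : ℕ) (p : ℤ) => if |p| ≤ ((K * q : ℕ) : ℤ) then
    ENNReal.ofReal ((q : ℝ) ^ (-s)) else 0)]
  have hle : ∀ q : ℕ, ∑' p : ℤ, (if |p| ≤ ((K * q : ℕ) : ℤ) then
      ENNReal.ofReal ((q : ℝ) ^ (-s)) else 0) ≤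
      (2 * K + 1) * ENNReal.ofReal ((q : ℝ) ^ (-(s - 1))) := by
    intro q
    rw [tsum_int_abs_le]
    -- The spurious denominator `0` contributes nothing, as `0 ^ (-s) = 0` for real powers with `s ≠
    -- 0`.
    rcases Nat.eq_zero_or_pos q with rfl | hq
    · rw [Nat.cast_zero, Real.zero_rpow (by linarith)]; simp
    have hq' : (0 : ℝ) < q := by exact_mod_cast hq
    have h1 : ((q : ℝ) ^ (-(s - 1))) = q * (q : ℝ) ^ (-s) := by
      rw [show -(s - 1) = 1 + -s by ring, Real.rpow_add hq', Real.rpow_one]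
    rw [h1, ENNReal.ofReal_mul hq'.le, ← mul_assoc, ENNReal.ofReal_natCast]
    gcongr
    have : 2 * (K * q) + 1 ≤ (2 * K + 1) * q := by nlinarith
    exact_mod_cast this
  refine ne_top_of_le_ne_top ?_ (ENNReal.tsum_le_tsum hle)
  rw [ENNReal.tsum_mul_left]
  exact ENNReal.mul_ne_top (by finiteness) (tsum_ofReal_rpow_neg_ne_top (by linarith))

theorem num_abs_le_of_abs_sub_le {x : ℝ} {K : ℕ} {r : ℚ} (hx : |x| ≤ K) (hr : |x - r| ≤ 1) :
    |r.num| ≤ (((K + 1) * r.den : ℕ) : ℤ) := by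
  have h1 : |(r : ℝ)| ≤ K + 1 := by
    rw [abs_le] at *
    constructor <;> linarith
  have hden : (0 : ℝ) < r.den := by exact_mod_cast r.den_pos
  rw [Rat.cast_def, abs_div, abs_of_pos hden, div_le_iff₀ hden] at h1
  exact_mod_cast h1

theorem hausdorffMeasure_wellApproximable_eq_zero {t d : ℝ} (ht : 0 < t) (hd : 2 < t * d)
    (K : ℕ) :
    Measure.hausdorffMeasure d
      {x : ℝ | |x| ≤ K ∧ {r : ℚ | |x - (r : ℝ)| ≤ (r.den : ℝ) ^ (-t)}.Infinite} = 0 := by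
  have hd0 : 0 < d := by
    by_contra! h
    nlinarith
  set B : ℕ × ℤ → Set ℝ := fun z => if |z.2| ≤ (((K + 1) * z.1 : ℕ) : ℤ) then
    Metric.closedBall ((z.2 : ℝ) / z.1) ((z.1 : ℝ) ^ (-t)) else ∅ with hB
  refine measure_mono_null (t := {x | {i | x ∈ B i}.Infinite}) ?_
    (hausdorffMeasure_setOf_infinite_eq_zero B hd0 ?_)
  · rintro x ⟨hxK, hx⟩
    refine (hx.image (f := fun r : ℚ => (r.den, r.num)) ?_).mono ?_
    · intro r _ r' _ h
      simp only [Prod.mk.injEq] at h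
      exact Rat.ext h.2 h.1
    · rintro _ ⟨r, hr, rfl⟩
      have hden : (1 : ℝ) ≤ r.den := by exact_mod_cast r.den_pos
      have h1 : |x - r| ≤ 1 := le_trans hr (Real.rpow_le_one_of_one_le_of_nonpos hden (by linarith))
      have h2 := num_abs_le_of_abs_sub_le hxK h1
      simp only [Set.mem_ofPred_eq, hB, if_pos h2, Metric.mem_closedBall, Real.dist_eq]
      rw [← Rat.cast_def]
      exact hr
  · have hle : ∀ z : ℕ × ℤ, Metric.ediam (B z) ^ d ≤ 2 ^ d *
        (if |z.2| ≤ (((K + 1) * z.1 : ℕ) : ℤ) then ENNReal.ofReal ((z.1 : ℝ) ^ (-(t * d))) else 0)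
        := by
      intro z
      by_cases hz : |z.2| ≤ (((K + 1) * z.1 : ℕ) : ℤ)
      · simp only [hB, if_pos hz]
        have hnn : (0 : ℝ) ≤ (z.1 : ℝ) ^ (-t) := by positivity
        rw [← Metric.closedEBall_ofReal hnn]
        refine (ENNReal.rpow_le_rpow Metric.ediam_closedEBall_le hd0.le).trans ?_
        rw [ENNReal.mul_rpow_of_nonneg _ _ hd0.le, ENNReal.ofReal_rpow_of_nonneg hnn hd0.le,
          ← Real.rpow_mul (by positivity), neg_mul]
      · simp only [hB, if_neg hz]
        simp [hd0]
    refine ne_top_of_le_ne_top ?_ (ENNReal.tsum_le_tsum hle)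
    rw [ENNReal.tsum_mul_left]
    exact ENNReal.mul_ne_top (by finiteness) (tsum_fractions_ne_top (K + 1) hd)

theorem infinite_of_lt_irrationalityExponent {x t : ℝ} (h : (t : EReal) < irrationalityExponent x) :
    {r : ℚ | |x - (r : ℝ)| ≤ (r.den : ℝ) ^ (-t)}.Infinite := by
  obtain ⟨_, ⟨τ, hτ, rfl⟩, hlt⟩ := lt_sSup_iff.1 h
  have hlt' : t < τ := EReal.coe_lt_coe_iff.1 hlt
  refine Set.Infinite.mono ?_ hτ
  intro r hr
  have hden : (1 : ℝ) ≤ r.den := by exact_mod_cast r.den_pos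
  exact le_trans hr (Real.rpow_le_rpow_of_exponent_le hden (by linarith))

/-- The upper bound in the Jarník–Besicovitch theorem. -/
theorem dimH_exponentSet_le {lam : ℝ} (hlam : 0 < lam) (mu : EReal) :
    dimH (exponentSet lam mu) ≤ ENNReal.ofReal (2 / lam) := by
  refine ENNReal.le_of_forall_pos_le_add fun ε hε _ => ?_
  set d : ℝ := 2 / lam + ε with hd
  have hε' : (0 : ℝ) < ε := by exact_mod_cast hε
  have hdpos : 0 < d := by positivity
  have h2 : 2 / d < lam := by
    rw [div_lt_iff₀ hdpos, hd, mul_add, mul_div_cancel₀ _ hlam.ne']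
    nlinarith [mul_pos hlam hε']
  obtain ⟨t, ht1, ht2⟩ := exists_between h2
  have ht0 : 0 < t := lt_trans (by positivity) ht1
  have htd : 2 < t * d := (div_lt_iff₀ hdpos).1 ht1
  have hsub : exponentSet lam mu ⊆ ⋃ K : ℕ,
      {x : ℝ | |x| ≤ K ∧ {r : ℚ | |x - (r : ℝ)| ≤ (r.den : ℝ) ^ (-t)}.Infinite} := by
    intro x hx
    obtain ⟨K, hK⟩ := exists_nat_ge |x|
    exact Set.mem_iUnion.2 ⟨K, hK, infinite_of_lt_irrationalityExponent
      (lt_of_lt_of_le (by exact_mod_cast ht2) hx.1)⟩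
  have hzero : Measure.hausdorffMeasure d (exponentSet lam mu) = 0 :=
    measure_mono_null hsub (measure_iUnion_null fun K =>
      hausdorffMeasure_wellApproximable_eq_zero ht0 htd K)
  have : dimH (exponentSet lam mu) ≤ (d.toNNReal : ℝ≥0∞) := by
    apply dimH_le_of_hausdorffMeasure_ne_top
    rw [Real.coe_toNNReal _ hdpos.le, hzero]
    exact ENNReal.zero_ne_top
  refine this.trans (le_of_eq ?_)
  change ENNReal.ofReal d = _
  rw [hd, ENNReal.ofReal_add (by positivity) hε'.le, ENNReal.ofReal_coe_nnreal]

/-! ### Generic differences. -/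

/-- Almost every real number is badly approximable by fractions whose denominators are
multiples of terms of a sparse sequence `Q`. -/
theorem ae_forall_abs_sub_fraction_ge {δ : ℝ} (hδ : 0 < δ) (Q : ℕ → ℕ) (hQ : ∀ k, 1 ≤ Q k)
    (hsum : ∑' k, ENNReal.ofReal ((Q k : ℝ) ^ (-δ)) ≠ ∞) :
    ∀ᵐ t : ℝ, ∃ q₀ : ℕ, ∀ q ≥ q₀, 1 ≤ q → ∀ (k : ℕ) (P : ℤ),
      (q : ℝ) ^ (-(2 + δ)) * (Q k : ℝ) ^ (-(1 + δ)) ≤ |t - P / (q * Q k)| := by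
  have main : ∀ K : ℕ, ∀ᵐ t : ℝ, |t| ≤ K → ∃ q₀ : ℕ, ∀ q ≥ q₀, 1 ≤ q → ∀ (k : ℕ) (P : ℤ),
      (q : ℝ) ^ (-(2 + δ)) * (Q k : ℝ) ^ (-(1 + δ)) ≤ |t - P / (q * Q k)| := by
    intro K
    set ρ : ℕ → ℕ → ℝ := fun k q => (q : ℝ) ^ (-(2 + δ)) * (Q k : ℝ) ^ (-(1 + δ)) with hρ
    set B : ℕ × ℕ × ℤ → Set ℝ := fun z =>
      if |z.2.2| ≤ (((K + 1) * Q z.1 * z.2.1 : ℕ) : ℤ) then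
        Metric.ball ((z.2.2 : ℝ) / (z.2.1 * Q z.1)) (ρ z.1 z.2.1) else ∅ with hB
    have hfin : ∑' z, volume (B z) ≠ ∞ := by
      have hvol : ∀ z, volume (B z) = if |z.2.2| ≤ (((K + 1) * Q z.1 * z.2.1 : ℕ) : ℤ) then
          ENNReal.ofReal (2 * ρ z.1 z.2.1) else 0 := by
        intro z
        simp only [hB]
        split_ifs
        · rw [Real.volume_ball]
        · simp
      -- About `q * Q k` numerators, each with a ball of radius `ρ k q`: the product is summable in
      -- `q` and `k` separately.
      have hle : ∀ k q : ℕ, ∑' p : ℤ, volume (B (k, q, p)) ≤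
          ((2 * K + 3) * 2 * ENNReal.ofReal ((q : ℝ) ^ (-(1 + δ)))) *
            ENNReal.ofReal ((Q k : ℝ) ^ (-δ)) := by
        intro k q
        simp only [hvol]
        rw [tsum_int_abs_le]
        rcases Nat.eq_zero_or_pos q with rfl | hq
        · simp only [hρ, Nat.cast_zero]
          rw [Real.zero_rpow (by linarith)]
          simp
        have hq' : (0 : ℝ) < q := by exact_mod_cast hq
        have hQ' : (0 : ℝ) < Q k := by exact_mod_cast hQ k
        have h1 : (q : ℝ) ^ (-(1 + δ)) = q * (q : ℝ) ^ (-(2 + δ)) := by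
          rw [show -(1 + δ) = 1 + -(2 + δ) by ring, Real.rpow_add hq', Real.rpow_one]
        have h2 : (Q k : ℝ) ^ (-δ) = Q k * (Q k : ℝ) ^ (-(1 + δ)) := by
          rw [show -δ = 1 + -(1 + δ) by ring, Real.rpow_add hQ', Real.rpow_one]
        have h3 : ((2 * ((((K + 1) * Q k * q : ℕ)) : ℝ≥0∞)) + 1) ≤ (2 * K + 3) * (Q k * q) := by
          have h4 : 1 ≤ Q k * q := Nat.mul_pos (hQ k) hq
          have : 2 * ((K + 1) * Q k * q) + 1 ≤ (2 * K + 3) * (Q k * q) := by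
            calc 2 * ((K + 1) * Q k * q) + 1 ≤ 2 * ((K + 1) * Q k * q) + Q k * q := by omega
              _ = (2 * K + 3) * (Q k * q) := by ring
          exact_mod_cast this
        calc _ ≤ ((2 * K + 3) * (Q k * q)) * ENNReal.ofReal (2 * ρ k q) := by gcongr
          _ = _ := by
            simp only [hρ]
            rw [h1, h2, ENNReal.ofReal_mul (by norm_num), ENNReal.ofReal_mul (by positivity),
              ENNReal.ofReal_mul hq'.le, ENNReal.ofReal_mul hQ'.le, ENNReal.ofReal_natCast,
              ENNReal.ofReal_natCast, ENNReal.ofReal_ofNat]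
            ring
      rw [ENNReal.tsum_prod (f := fun k (z : ℕ × ℤ) => volume (B (k, z)))]
      refine ne_top_of_le_ne_top ?_ (ENNReal.tsum_le_tsum fun k => (le_of_eq
        (ENNReal.tsum_prod (f := fun q p => volume (B (k, q, p))))).trans
          (ENNReal.tsum_le_tsum (hle k)))
      simp_rw [ENNReal.tsum_mul_right, ENNReal.tsum_mul_left]
      exact ENNReal.mul_ne_top (ENNReal.mul_ne_top (by finiteness)
        (tsum_ofReal_rpow_neg_ne_top (by linarith))) hsum
    filter_upwards [ae_finite_setOfPred_mem hfin] with t ht htK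
    -- By Borel–Cantelli only finitely many balls contain `t`; bounding their `q` gives a threshold
    -- uniform in `k`.
    obtain ⟨M, hM⟩ := (ht.image fun z => z.2.1).bddAbove
    refine ⟨M + 1, fun q hqM hq k P => ?_⟩
    by_contra! hlt
    have hq' : (1 : ℝ) ≤ q := by exact_mod_cast hq
    have hQ' : (1 : ℝ) ≤ Q k := by exact_mod_cast hQ k
    have hle1 : ρ k q ≤ 1 := mul_le_one₀
      (Real.rpow_le_one_of_one_le_of_nonpos hq' (by linarith)) (by positivity)
      (Real.rpow_le_one_of_one_le_of_nonpos hQ' (by linarith))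
    have hP : |P| ≤ (((K + 1) * Q k * q : ℕ) : ℤ) := by
      have h1 : |(P : ℝ) / (q * Q k)| ≤ K + 1 := by
        have := hlt.le.trans hle1
        rw [abs_le] at *
        constructor <;> linarith
      rw [abs_div, abs_of_pos (a := (q : ℝ) * Q k) (by positivity),
        div_le_iff₀ (by positivity)] at h1
      have h2 : |(P : ℝ)| ≤ (K + 1) * Q k * q := by linarith
      exact_mod_cast h2
    have hmem : ((k, q, P) : ℕ × ℕ × ℤ) ∈ {z | t ∈ B z} := by
      simp only [Set.mem_ofPred_eq, hB, if_pos hP, Metric.mem_ball, Real.dist_eq]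
      exact hlt
    have := hM (Set.mem_image_of_mem (fun z : ℕ × ℕ × ℤ => z.2.1) hmem)
    simp only at this
    omega
  filter_upwards [ae_all_iff.2 main] with t ht
  obtain ⟨K, hK⟩ := exists_nat_ge |t|
  exact ht K hK

theorem ae_comp_linearMap {E : Type*} [NormedAddCommGroup E] [NormedSpace ℝ E]
    [FiniteDimensional ℝ E] [MeasurableSpace E] [BorelSpace E] (μ : Measure E) [μ.IsAddHaarMeasure]
    (L : E →ₗ[ℝ] ℝ) (hL : L ≠ 0) {p : ℝ → Prop} (hp : ∀ᵐ t : ℝ, p t) : ∀ᵐ x ∂μ, p (L x) := by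
  have hsurj : Function.Surjective L := LinearMap.surjective hL
  have hnull : volume {t | ¬ p t} = 0 := hp
  have h := (ae_comp_linearMap_mem_iff L μ volume hsurj
    (measurableSet_toMeasurable volume {t | ¬ p t}).compl).2
    (by rw [← measure_toMeasurable] at hnull; exact measure_eq_zero_iff_ae_notMem.1 hnull)
  filter_upwards [h] with x hx
  by_contra hn
  exact hx (subset_toMeasurable volume _ hn)

/-! ### Construction of the common translate. -/

/-- For targets `a k` and sparse scales `2 ^ m k` there is one shift `s` such that every `a k - s`
is at distance comparable to `2 ^ (-lam * m k)` from a reduced fraction of denominator `2 ^ m k`. -/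
theorem exists_forall_odd_approx {lam : ℝ} (hlam : 1 ≤ lam) (m : ℕ → ℕ)
    (hm : ∀ k, lam * m k + 3 ≤ m (k + 1)) (a : ℕ → ℝ) :
    ∃ s : ℝ, ∀ k, ∃ p : ℤ, Odd p ∧ (2 : ℝ) ^ (-(lam * m k + 1)) ≤ (a k - s) - p / 2 ^ m k ∧
      (a k - s) - p / 2 ^ m k ≤ (2 : ℝ) ^ (-(lam * m k)) := by
  set r : ℕ → ℝ := fun k => (2 : ℝ) ^ (-(lam * m k)) with hr
  have hr0 : ∀ k, 0 < r k := fun k => by positivity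
  have hhalf : ∀ k, (2 : ℝ) ^ (-(lam * m k + 1)) = r k / 2 := by
    intro k
    rw [neg_add, Real.rpow_add (by norm_num), Real.rpow_neg_one]
    rfl
  have hq : ∀ k, 8 ≤ r k * 2 ^ m (k + 1) := by
    intro k
    rw [← Real.rpow_natCast 2 (m (k + 1)), ← Real.rpow_add (by norm_num)]
    calc (8 : ℝ) = 2 ^ (3 : ℝ) := by norm_num
      _ ≤ _ := Real.rpow_le_rpow_of_exponent_le (by norm_num) (by linarith [hm k])
  have hr1 : ∀ k, r k * 2 ^ m k ≤ 1 := by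
    intro k
    rw [← Real.rpow_natCast 2 (m k), ← Real.rpow_add (by norm_num)]
    apply Real.rpow_le_one_of_one_le_of_nonpos (by norm_num)
    nlinarith [(Nat.cast_nonneg (m k) : (0 : ℝ) ≤ m k)]
  have step : ∀ (k : ℕ) (p : ℤ), ∃ p' : ℤ, Odd p' ∧
      a k - p / 2 ^ m k - r k ≤ a (k + 1) - p' / 2 ^ m (k + 1) - r (k + 1) ∧
      a (k + 1) - p' / 2 ^ m (k + 1) - r (k + 1) / 2 ≤ a k - p / 2 ^ m k - r k / 2 := by
    intro k p
    set A := a k - p / 2 ^ m k - r k with hA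
    set z := (a (k + 1) - A - r (k + 1)) * 2 ^ m (k + 1) with hz
    have hN : (0 : ℝ) < 2 ^ m (k + 1) := by positivity
    -- The largest odd integer not exceeding `z`: the new left endpoint falls just right of the old
    -- one, `A`.
    refine ⟨2 * ⌊(z - 1) / 2⌋ + 1, odd_two_mul_add_one _, ?_, ?_⟩
    · have h1 := Int.floor_le ((z - 1) / 2)
      have h2 : ((2 * ⌊(z - 1) / 2⌋ + 1 : ℤ) : ℝ) / 2 ^ m (k + 1) ≤ a (k + 1) - A - r (k + 1) := by
        rw [div_le_iff₀ hN, ← hz]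
        push_cast
        linarith
      linarith
    · have h1 := Int.lt_floor_add_one ((z - 1) / 2)
      have h2 : (a (k + 1) - A - r (k + 1)) - 2 / 2 ^ m (k + 1) ≤
          ((2 * ⌊(z - 1) / 2⌋ + 1 : ℤ) : ℝ) / 2 ^ m (k + 1) := by
        rw [le_div_iff₀ hN, sub_mul, ← hz, div_mul_cancel₀ _ hN.ne']
        push_cast
        linarith
      -- The `+ 3` in `hm` makes the spacing of odd numerators and the new interval short against
      -- the old length `r k / 2`.
      have h3 : 2 / (2 : ℝ) ^ m (k + 1) ≤ r k / 4 := by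
        rw [div_le_iff₀ hN]
        linarith [hq k]
      have h4 : r (k + 1) ≤ r k / 8 := by
        have := hr1 (k + 1)
        have := hq k
        by_contra! hcon
        nlinarith
      linarith [hr0 k]
  choose f hf using step
  obtain ⟨p, hp0, hps⟩ : ∃ p : ℕ → ℤ, p 0 = 1 ∧ ∀ k, p (k + 1) = f k (p k) :=
    ⟨fun k => Nat.rec 1 f k, rfl, fun k => rfl⟩
  have hodd : ∀ k, Odd (p k) := by
    intro k
    cases k with
    | zero => rw [hp0]; exact odd_one
    | succ k => rw [hps]; exact (hf k (p k)).1
  have hanti : Antitone fun k =>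
      Set.Icc (a k - (p k : ℝ) / 2 ^ m k - r k) (a k - (p k : ℝ) / 2 ^ m k - r k / 2) := by
    refine antitone_nat_of_succ_le fun k => Set.Icc_subset_Icc ?_ ?_
    · rw [hps]; exact (hf k (p k)).2.1
    · rw [hps]; exact (hf k (p k)).2.2
  obtain ⟨s, hs⟩ : (⋂ k, Set.Icc (a k - (p k : ℝ) / 2 ^ m k - r k)
      (a k - (p k : ℝ) / 2 ^ m k - r k / 2)).Nonempty :=
    ⟨_, ciSup_mem_iInter_Icc_of_antitone_Icc hanti fun k => by linarith [hr0 k]⟩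
  refine ⟨s, fun k => ⟨p k, hodd k, ?_, ?_⟩⟩
  · have := (Set.mem_iInter.1 hs k).2
    rw [hhalf]
    linarith
  · have := (Set.mem_iInter.1 hs k).1
    change _ ≤ r k
    linarith

/-! ### From distances to fractions to exponents. -/

theorem irrationalityExponent_le {x mu : ℝ} (hmu : 0 ≤ mu)
    (h : ∀ τ > mu, ∃ q₀ : ℕ, ∀ r : ℚ, q₀ ≤ r.den → (r.den : ℝ) ^ (-τ) < |x - r|) :
    irrationalityExponent x ≤ mu := by
  refine sSup_le ?_
  rintro _ ⟨τ, hτ, rfl⟩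
  rw [EReal.coe_le_coe_iff]
  by_contra! hlt
  obtain ⟨q₀, hq₀⟩ := h τ hlt
  obtain ⟨K, hK⟩ := exists_nat_ge |x|
  apply hτ
  refine Set.Finite.of_finite_image (f := fun r : ℚ => ((r.den, r.num) : ℕ × ℤ)) ?_ ?_
  · refine ((Set.finite_Iic q₀).prod (Set.finite_Icc (-(((K + 1) * q₀ : ℕ) : ℤ))
      (((K + 1) * q₀ : ℕ) : ℤ))).subset ?_
    rintro _ ⟨r, hr, rfl⟩
    have hden : (1 : ℝ) ≤ r.den := by exact_mod_cast r.den_pos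
    have h1 : |x - r| ≤ 1 := le_trans hr (Real.rpow_le_one_of_one_le_of_nonpos hden (by linarith))
    have h2 := num_abs_le_of_abs_sub_le hK h1
    have h3 : r.den ≤ q₀ := by
      by_contra! hcon
      exact absurd hr (not_le.2 (hq₀ r hcon.le))
    have h4 : (((K + 1) * r.den : ℕ) : ℤ) ≤ (((K + 1) * q₀ : ℕ) : ℤ) := by
      exact_mod_cast Nat.mul_le_mul_left _ h3
    exact ⟨h3, abs_le.1 (h2.trans h4)⟩
  · intro r _ r' _ h
    simp only [Prod.mk.injEq] at h
    exact Rat.ext h.2 h.1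

theorem le_irrationalityExponent {x lam : ℝ}
    (h : ∀ ε > 0, ∃ r : ℚ, 0 < |x - r| ∧ |x - r| < ε ∧ |x - r| ≤ (r.den : ℝ) ^ (-lam)) :
    lam ≤ irrationalityExponent x := by
  refine le_sSup ⟨lam, ?_, rfl⟩
  intro hfin
  have hfin' : {r : ℚ | 0 < |x - r| ∧ |x - r| ≤ (r.den : ℝ) ^ (-lam)}.Finite :=
    hfin.subset fun r hr => hr.2
  obtain ⟨r₁, h1, -, h2⟩ := h 1 one_pos
  obtain ⟨r₀, hr₀, hmin⟩ := Set.exists_min_image _ (fun r : ℚ => |x - r|) hfin' ⟨r₁, h1, h2⟩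
  obtain ⟨r, h3, h4, h5⟩ := h _ hr₀.1
  exact absurd (hmin r ⟨h3, h5⟩) (not_le.2 h4)

theorem den_div_two_pow {p : ℤ} (hp : Odd p) (m : ℕ) :
    ((p : ℚ) / ((2 ^ m : ℤ) : ℚ)).den = 2 ^ m := by
  have : (((p : ℚ) / ((2 ^ m : ℤ) : ℚ)).den : ℤ) = 2 ^ m := by
    apply Rat.den_div_eq_of_coprime (by positivity)
    rw [Int.natAbs_pow]
    exact Nat.Coprime.pow_right m (Int.natAbs_odd.2 hp).coprime_two_right
  exact_mod_cast this

/-- Distinct fractions with denominators `r.den` and `2 ^ m` differ by at least `1 / (r.den * 2 ^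
m)`, at least twice the distance from `x` to `p / 2 ^ m`. If they coincide, oddness forces `r.den =
2 ^ m` and `h1` applies. -/
theorem abs_sub_rat_ge_of_odd_approx {x lam : ℝ} {m : ℕ} {p : ℤ} (hp : Odd p)
    (h1 : (2 : ℝ) ^ (-(lam * m + 1)) ≤ x - p / 2 ^ m) (h2 : x - p / 2 ^ m ≤ (2 : ℝ) ^ (-(lam * m)))
    (r : ℚ) (hr : Real.logb 2 r.den + m + 1 ≤ lam * m) :
    (2 : ℝ) ^ (-(Real.logb 2 r.den + m + 1)) ≤ |x - r| ∨
      (2 : ℝ) ^ (-(lam * Real.logb 2 r.den + 1)) ≤ |x - r| := by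
  have hden : (0 : ℝ) < r.den := by exact_mod_cast r.den_pos
  by_cases hrp : r = (p : ℚ) / ((2 ^ m : ℤ) : ℚ)
  · right
    have hd : r.den = 2 ^ m := by rw [hrp]; exact den_div_two_pow hp m
    have hL : Real.logb 2 r.den = m := by
      have : (r.den : ℝ) = 2 ^ (m : ℝ) := by rw [Real.rpow_natCast]; exact_mod_cast hd
      rw [this, Real.logb_rpow (by norm_num) (by norm_num)]
    have hx : (r : ℝ) = p / 2 ^ m := by rw [hrp]; push_cast; rfl
    rw [hL, hx]
    exact h1.trans (le_abs_self _)
  · left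
    have hne : r.num * 2 ^ m - p * r.den ≠ 0 := by
      intro h0
      apply hrp
      rw [eq_div_iff (by positivity)]
      nth_rewrite 1 [← Rat.num_div_den r]
      rw [div_mul_eq_mul_div, div_eq_iff (by exact_mod_cast r.den_nz)]
      exact_mod_cast sub_eq_zero.1 h0
    have h3 : (1 : ℝ) ≤ |(r.num * 2 ^ m - p * r.den : ℝ)| := by
      exact_mod_cast Int.one_le_abs hne
    have h4 : (2 : ℝ) ^ (-(Real.logb 2 r.den + m)) ≤ |(p : ℝ) / 2 ^ m - r| := by
      rw [abs_sub_comm, Real.rpow_neg (by norm_num), Real.rpow_add (by norm_num),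
        Real.rpow_logb (by norm_num) (by norm_num) hden, Real.rpow_natCast]
      have : (r : ℝ) - p / 2 ^ m = (r.num * 2 ^ m - p * r.den) / (r.den * 2 ^ m) := by
        rw [Rat.cast_def]
        field_simp
      rw [this, abs_div, abs_of_pos (a := (r.den : ℝ) * 2 ^ m) (by positivity), inv_eq_one_div]
      gcongr
    have h5 : (2 : ℝ) ^ (-(lam * m)) ≤ 2 ^ (-(Real.logb 2 r.den + m + 1)) :=
      Real.rpow_le_rpow_of_exponent_le (by norm_num) (by linarith)
    have h6 : (2 : ℝ) ^ (-(Real.logb 2 r.den + m)) =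
        2 * 2 ^ (-(Real.logb 2 r.den + m + 1)) := by
      rw [neg_add _ (1 : ℝ), Real.rpow_add (by norm_num), Real.rpow_neg_one]
      ring
    have h7 : (0 : ℝ) < 2 ^ (-(lam * m + 1)) := by positivity
    have h8 : |x - p / 2 ^ m| ≤ (2 : ℝ) ^ (-(lam * m)) := by
      rw [abs_of_pos (by linarith)]; exact h2
    have h9 : |(p : ℝ) / 2 ^ m - r| ≤ |x - r| + |x - p / 2 ^ m| := by
      rw [show (p : ℝ) / 2 ^ m - r = (x - r) - (x - p / 2 ^ m) by ring]
      exact abs_sub _ _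
    linarith

/-- Here `p / 2 ^ m` approximates another coordinate `x - t`. If `x` were too close to `r`, then `t`
would be too close to `r - p / 2 ^ m`, whose denominator divides `r.den * 2 ^ m`. -/
theorem abs_sub_rat_ge_of_generic_difference {x t lam δ : ℝ} {m : ℕ} {p : ℤ}
    (h : |(x - t) - p / 2 ^ m| ≤ (2 : ℝ) ^ (-(lam * m))) (r : ℚ)
    (ht : ∀ P : ℤ, (r.den : ℝ) ^ (-(2 + δ)) * ((2 ^ m : ℕ) : ℝ) ^ (-(1 + δ)) ≤
      |t - P / (r.den * (2 ^ m : ℕ))|)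
    (hr : (2 + δ) * Real.logb 2 r.den + (1 + δ) * m + 1 ≤ lam * m) :
    (2 : ℝ) ^ (-((2 + δ) * Real.logb 2 r.den + (1 + δ) * m + 1)) ≤ |x - r| := by
  have hden : (0 : ℝ) < r.den := by exact_mod_cast r.den_pos
  set L := Real.logb 2 r.den with hL
  have hdL : (r.den : ℝ) = 2 ^ L := (Real.rpow_logb (by norm_num) (by norm_num) hden).symm
  have h1 := ht (r.num * 2 ^ m - p * r.den)
  have h2 : (r.den : ℝ) ^ (-(2 + δ)) * ((2 ^ m : ℕ) : ℝ) ^ (-(1 + δ)) =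
      2 * 2 ^ (-((2 + δ) * L + (1 + δ) * m + 1)) := by
    have h2m : ((2 ^ m : ℕ) : ℝ) = 2 ^ (m : ℝ) := by rw [Real.rpow_natCast]; push_cast; rfl
    rw [hdL, h2m, ← Real.rpow_mul (by norm_num), ← Real.rpow_mul (by norm_num),
      ← Real.rpow_add (by norm_num)]
    rw [show L * -(2 + δ) + m * -(1 + δ) = 1 + -((2 + δ) * L + (1 + δ) * m + 1) by ring,
      Real.rpow_add (by norm_num), Real.rpow_one]
  have h3 : t - ((r.num * 2 ^ m - p * r.den : ℤ) : ℝ) / (r.den * (2 ^ m : ℕ)) =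
      (x - r) - ((x - t) - p / 2 ^ m) := by
    rw [Rat.cast_def]
    push_cast
    field_simp
    ring
  have h4 : (2 : ℝ) ^ (-(lam * m)) ≤ 2 ^ (-((2 + δ) * L + (1 + δ) * m + 1)) :=
    Real.rpow_le_rpow_of_exponent_le (by norm_num) (by linarith)
  rw [h2, h3] at h1
  have h5 := abs_sub (x - r) ((x - t) - p / 2 ^ m)
  linarith

/-! ### Choice of the scale for a given denominator. -/

theorem le_scale_sequence {lam : ℝ} (hlam : 1 ≤ lam) {m : ℕ → ℕ}
    (hm : ∀ k, lam * m k + 3 ≤ m (k + 1)) (k : ℕ) : k ≤ m k := by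
  induction k with
  | zero => omega
  | succ k ih =>
    have : ((m k : ℝ)) + 1 ≤ m (k + 1) := by
      nlinarith [hm k, (Nat.cast_nonneg (m k) : (0 : ℝ) ≤ m k)]
    have : m k + 1 ≤ m (k + 1) := by exact_mod_cast this
    omega

open Filter in
/-- For every large `L` (the logarithm of a denominator) some scale `m j` yields a lower bound
`2 ^ (-τ * L)`, either through the fraction approximating the number itself (`S j`) or through
a generic difference (`¬ S j`). -/
theorem exists_forall_ge_exists_index {lam τ δ : ℝ} (hlam : 2 < lam) (hδ : 0 < δ)
    (hδlam : δ < lam - 1) (m : ℕ → ℕ) (hm : ∀ k, lam * m k + 3 ≤ m (k + 1))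
    (hm' : ∀ k, (m (k + 1) : ℝ) ≤ lam * m k + 4) (S : ℕ → Prop)
    (h1 : 1 + lam * (2 + δ) / (lam - 1 - δ) < τ)
    (h2 : (∀ k, ¬ S (k + 1) → S k) ∧ 2 + δ + (1 + δ) * (lam / (lam - 1)) < τ ∨
      2 + δ + (1 + δ) * (lam * (2 + δ) / (lam - 1 - δ)) < τ) :
    ∃ L₀ : ℝ, ∀ L ≥ L₀, ∃ j,
      (S j ∧ L + m j + 1 ≤ lam * m j ∧ L + m j + 1 < τ * L) ∨
      (¬ S j ∧ (2 + δ) * L + (1 + δ) * m j + 1 ≤ lam * m j ∧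
        (2 + δ) * L + (1 + δ) * m j + 1 < τ * L) := by
  set D := lam - 1 - δ with hD
  have hD0 : 0 < D := by linarith
  set α := lam * (2 + δ) / D with hα
  set β := lam / (lam - 1) with hβ
  have large : ∀ {c : ℝ} (C : ℝ), c < τ → ∀ᶠ L : ℝ in atTop, c * L + C < τ * L := by
    intro c C hc
    filter_upwards [eventually_gt_atTop (C / (τ - c))] with L hL
    rw [div_lt_iff₀ (by linarith)] at hL
    linarith
  have hev : ∀ᶠ L : ℝ in atTop, ∃ j,
      (S j ∧ L + m j + 1 ≤ lam * m j ∧ L + m j + 1 < τ * L) ∨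
      (¬ S j ∧ (2 + δ) * L + (1 + δ) * m j + 1 ≤ lam * m j ∧
        (2 + δ) * L + (1 + δ) * m j + 1 < τ * L) := by
    have hlast : ∀ᶠ L : ℝ in atTop,
        2 + δ + (1 + δ) * β < τ → (2 + δ + (1 + δ) * β) * L + ((1 + δ) * (β + 4) + 1) < τ * L := by
      by_cases h : 2 + δ + (1 + δ) * β < τ
      · filter_upwards [large ((1 + δ) * (β + 4) + 1) h] with L hL _ using hL
      · exact Eventually.of_forall fun L h' => absurd h' h
    have hlast' : ∀ᶠ L : ℝ in atTop,
        2 + δ + (1 + δ) * α < τ →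
          (2 + δ + (1 + δ) * α) * L + ((1 + δ) * (lam / D + 4) + 1) < τ * L := by
      by_cases h : 2 + δ + (1 + δ) * α < τ
      · filter_upwards [large ((1 + δ) * (lam / D + 4) + 1) h] with L hL _ using hL
      · exact Eventually.of_forall fun L h' => absurd h' h
    filter_upwards [large (lam / D + 5) h1, hlast, hlast', eventually_ge_atTop 1,
      eventually_gt_atTop (lam * m 0)] with L e1 e2 e3 hL1 hL0
    have hmk := le_scale_sequence (by linarith) hm
    have hex : ∃ j, (2 + δ) * L + (1 + δ) * m j + 1 ≤ lam * m j := by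
      obtain ⟨j, hj⟩ := exists_nat_ge (((2 + δ) * L + 1) / D)
      refine ⟨j, ?_⟩
      have h3 : ((2 + δ) * L + 1) / D ≤ m j := hj.trans (by exact_mod_cast hmk j)
      rw [div_le_iff₀ hD0] at h3
      linarith
    classical
    -- Take the first scale fine enough for the generic bound; failure at the preceding one bounds
    -- `m j` by about `α * L`.
    obtain ⟨hj, hmin⟩ := (⟨Nat.find_spec hex, fun i hi => Nat.find_min hex hi⟩ :
      _ ∧ ∀ i < Nat.find hex, ¬ ((2 + δ) * L + (1 + δ) * m i + 1 ≤ lam * m i))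
    generalize Nat.find hex = j at hj hmin
    have hδL : 0 < δ * L := by positivity
    cases j with
    | zero =>
      exfalso
      nlinarith [(Nat.cast_nonneg (m 0) : (0 : ℝ) ≤ m 0)]
    | succ i =>
      have hi := hmin i (Nat.lt_succ_self i)
      push Not at hi
      have hmi0 : (0 : ℝ) ≤ m i := Nat.cast_nonneg _
      have hmi : (m i : ℝ) ≤ ((2 + δ) * L + 1) / D := by
        rw [le_div_iff₀ hD0]
        linarith
      have hmj : (m (i + 1) : ℝ) ≤ α * L + (lam / D + 4) := by
        have : lam * m i ≤ lam * (((2 + δ) * L + 1) / D) := by gcongr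
        have h3 : lam * (((2 + δ) * L + 1) / D) = α * L + lam / D := by
          rw [hα]; field_simp
        linarith [hm' i]
      have hmij : (m i : ℝ) ≤ m (i + 1) := by nlinarith [hm i]
      have hmj0 : (0 : ℝ) ≤ δ * m (i + 1) := by positivity
      by_cases hS : S (i + 1)
      · exact ⟨i + 1, Or.inl ⟨hS, by linarith, by linarith⟩⟩
      -- With two alternating coordinates the preceding scale is the number's own: either it already
      -- serves, or its failure improves the bound on `m j` to about `β * L`.
      rcases h2 with ⟨hSS, hβτ⟩ | hατ
      · by_cases hA : L + m i + 1 ≤ lam * m i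
        · exact ⟨i, Or.inl ⟨hSS i hS, hA, by linarith⟩⟩
        · refine ⟨i + 1, Or.inr ⟨hS, hj, ?_⟩⟩
          push Not at hA
          have h3 : (m i : ℝ) ≤ (L + 1) / (lam - 1) := by
            rw [le_div_iff₀ (by linarith)]
            linarith
          have h4 : lam * m i ≤ lam * ((L + 1) / (lam - 1)) := by gcongr
          have h5 : lam * ((L + 1) / (lam - 1)) = β * L + β := by
            rw [hβ]; ring
          have h6 : (1 + δ) * m (i + 1) ≤ (1 + δ) * (β * L + (β + 4)) := by
            have := hm' i
            gcongr
            linarith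
          have := e2 hβτ
          linarith
      · refine ⟨i + 1, Or.inr ⟨hS, hj, ?_⟩⟩
        have h6 : (1 + δ) * m (i + 1) ≤ (1 + δ) * (α * L + (lam / D + 4)) := by gcongr
        have := e3 hατ
        linarith
  exact eventually_atTop.1 hev

theorem exists_scale_sequence {lam : ℝ} (hlam : 0 ≤ lam) :
    ∃ m : ℕ → ℕ, ∀ k, lam * m k + 3 ≤ m (k + 1) ∧ (m (k + 1) : ℝ) ≤ lam * m k + 4 := by
  refine ⟨fun k => Nat.rec 0 (fun _ a => ⌈lam * a⌉₊ + 3) k, fun k => ?_⟩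
  generalize hb : (Nat.rec 0 (fun _ a => ⌈lam * a⌉₊ + 3) k : ℕ) = b
  simp only [hb]
  have h1 := Nat.le_ceil (lam * b)
  have h2 := Nat.ceil_lt_add_one (a := lam * b) (by positivity)
  push_cast
  constructor <;> linarith

theorem tsum_two_pow_rpow_neg_ne_top {δ : ℝ} (hδ : 0 < δ) {m : ℕ → ℕ} (hm : ∀ k, k ≤ m k) :
    ∑' k, ENNReal.ofReal (((2 ^ m k : ℕ) : ℝ) ^ (-δ)) ≠ ∞ := by
  have hle : ∀ k, ENNReal.ofReal (((2 ^ m k : ℕ) : ℝ) ^ (-δ)) ≤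
      ENNReal.ofReal (((2 : ℝ) ^ (-δ)) ^ k) := by
    intro k
    apply ENNReal.ofReal_le_ofReal
    rw [Nat.cast_pow, Nat.cast_ofNat, ← Real.rpow_natCast, ← Real.rpow_natCast,
      ← Real.rpow_mul (by norm_num), ← Real.rpow_mul (by norm_num)]
    apply Real.rpow_le_rpow_of_exponent_le (by norm_num)
    have : (k : ℝ) ≤ m k := by exact_mod_cast hm k
    nlinarith
  refine ne_top_of_le_ne_top ?_ (ENNReal.tsum_le_tsum hle)
  exact (summable_geometric_of_lt_one (by positivity)
    (Real.rpow_lt_one_of_one_lt_of_neg (by norm_num) (by linarith))).tsum_ofReal_ne_top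

/-! ### Exponents of the translated coordinates. -/

/-- If the differences of the `y i` are generic, some common translate of the `y i` lies in
`exponentSet lam mu`. -/
theorem exists_forall_sub_mem_exponentSet {n : ℕ} (hn : 2 ≤ n) {lam mu δ : ℝ} (hlam : 2 < lam)
    (hle : lam ≤ mu) (hδ : 0 < δ) (hδlam : δ < lam - 1) {m : ℕ → ℕ}
    (hm : ∀ k, lam * m k + 3 ≤ m (k + 1)) (hm' : ∀ k, (m (k + 1) : ℝ) ≤ lam * m k + 4)
    (h1 : 1 + lam * (2 + δ) / (lam - 1 - δ) < mu)
    (h2 : n = 2 ∧ 2 + δ + (1 + δ) * (lam / (lam - 1)) < mu ∨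
      2 + δ + (1 + δ) * (lam * (2 + δ) / (lam - 1 - δ)) < mu)
    (y : Fin n → ℝ)
    (hy : ∀ i j, i ≠ j → ∃ q₀ : ℕ, ∀ q ≥ q₀, 1 ≤ q → ∀ (k : ℕ) (P : ℤ),
      (q : ℝ) ^ (-(2 + δ)) * ((2 ^ m k : ℕ) : ℝ) ^ (-(1 + δ)) ≤
        |(y i - y j) - P / (q * (2 ^ m k : ℕ))|) :
    ∃ s : ℝ, ∀ i, y i - s ∈ exponentSet lam mu := by
  have hn0 : 0 < n := by omega
  have hkm := le_scale_sequence (by linarith) hm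
  obtain ⟨s, hs⟩ := exists_forall_odd_approx (by linarith) m hm
    fun k => y ⟨k % n, Nat.mod_lt k hn0⟩
  refine ⟨s, fun i => ⟨?_, ?_⟩⟩
  · refine le_irrationalityExponent fun ε hε => ?_
    obtain ⟨N, hN⟩ := exists_pow_lt_of_lt_one hε (y := (1 / 2 : ℝ)) (by norm_num)
    -- An index belonging to coordinate `i` whose scale is at least `N`.
    obtain ⟨p, hp, hp1, hp2⟩ := hs (i + n * N)
    have hi : (⟨(i + n * N) % n, Nat.mod_lt _ hn0⟩ : Fin n) = i := by
      ext
      simp [Nat.mod_eq_of_lt i.2]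
    rw [hi] at hp1 hp2
    set M := m (i + n * N) with hM
    have hpos : (0 : ℝ) < y i - s - p / 2 ^ M := lt_of_lt_of_le (by positivity) hp1
    have hcast : (((p : ℚ) / ((2 ^ M : ℤ) : ℚ) : ℚ) : ℝ) = p / 2 ^ M := by push_cast; rfl
    refine ⟨(p : ℚ) / ((2 ^ M : ℤ) : ℚ), ?_, ?_, ?_⟩
    · rw [hcast]
      exact abs_pos.2 hpos.ne'
    · rw [hcast, abs_of_pos hpos]
      refine hp2.trans_lt (lt_of_le_of_lt ?_ hN)
      rw [one_div, inv_pow, ← Real.rpow_natCast, ← Real.rpow_neg (by norm_num)]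
      apply Real.rpow_le_rpow_of_exponent_le (by norm_num)
      have h3 : (N : ℝ) ≤ M := by
        have h4 : N ≤ M := le_trans (by nlinarith) (hkm (i + n * N))
        exact_mod_cast h4
      nlinarith [(Nat.cast_nonneg N : (0 : ℝ) ≤ N)]
    · rw [hcast, abs_of_pos hpos, den_div_two_pow hp]
      refine hp2.trans (le_of_eq ?_)
      rw [Nat.cast_pow, Nat.cast_ofNat, ← Real.rpow_natCast, ← Real.rpow_mul (by norm_num)]
      ring_nf
  · refine irrationalityExponent_le (by linarith) fun τ hτ => ?_
    obtain ⟨L₀, hL₀⟩ := exists_forall_ge_exists_index (τ := τ) hlam hδ hδlam m hm hm'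
      (fun k => k % n = i) (by linarith) (by
        rcases h2 with ⟨rfl, h2'⟩ | h2
        · left
          refine ⟨fun k hk => ?_, by linarith⟩
          have := i.2
          omega
        · right
          linarith)
    have hq : ∀ j, ∃ q₀ : ℕ, i ≠ j → ∀ q ≥ q₀, 1 ≤ q → ∀ (k : ℕ) (P : ℤ),
        (q : ℝ) ^ (-(2 + δ)) * ((2 ^ m k : ℕ) : ℝ) ^ (-(1 + δ)) ≤
          |(y i - y j) - P / (q * (2 ^ m k : ℕ))| := by
      intro j
      by_cases hij : i = j
      · exact ⟨0, fun h => absurd hij h⟩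
      · obtain ⟨q₀, h⟩ := hy i j hij
        exact ⟨q₀, fun _ => h⟩
    choose f hf using hq
    -- Beyond `1 / (τ - lam)` the gap `(τ - lam) * L` exceeds `1`, which settles the case where `r`
    -- is the approximant itself.
    obtain ⟨q₁, hq₁⟩ := exists_nat_ge ((2 : ℝ) ^ max L₀ (1 / (τ - lam) + 1))
    refine ⟨max q₁ (Finset.univ.sup f), fun r hr => ?_⟩
    have hden : (0 : ℝ) < r.den := by exact_mod_cast r.den_pos
    set L := Real.logb 2 r.den with hL
    have hL' : max L₀ (1 / (τ - lam) + 1) ≤ L := by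
      rw [hL, Real.le_logb_iff_rpow_le (by norm_num) hden]
      refine hq₁.trans ?_
      exact_mod_cast (le_max_left _ _).trans hr
    have hτ' : lam * L + 1 < τ * L := by
      have h3 : 1 / (τ - lam) < L := by linarith [(le_max_right _ _).trans hL']
      rw [div_lt_iff₀ (by linarith)] at h3
      linarith
    have hdL : (r.den : ℝ) ^ (-τ) = 2 ^ (-(τ * L)) := by
      rw [← Real.rpow_logb (b := 2) (by norm_num) (by norm_num) hden, ← hL,
        ← Real.rpow_mul (by norm_num)]
      ring_nf
    rw [hdL]
    have hlt : ∀ {e : ℝ}, e < τ * L → (2 : ℝ) ^ (-e) ≤ |(y i - s) - r| →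
        (2 : ℝ) ^ (-(τ * L)) < |(y i - s) - r| := fun he h =>
      (Real.rpow_lt_rpow_of_exponent_lt (by norm_num) (neg_lt_neg he)).trans_le h
    obtain ⟨j, hj⟩ := hL₀ L ((le_max_left _ _).trans hL')
    obtain ⟨p, hp, hp1, hp2⟩ := hs j
    rcases hj with ⟨hS, hj1, hj2⟩ | ⟨hS, hj1, hj2⟩
    · have hi : (⟨j % n, Nat.mod_lt _ hn0⟩ : Fin n) = i := Fin.ext hS
      rw [hi] at hp1 hp2
      rcases abs_sub_rat_ge_of_odd_approx hp hp1 hp2 r hj1 with h | h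
      · exact hlt hj2 h
      · exact hlt hτ' h
    · set i' : Fin n := ⟨j % n, Nat.mod_lt _ hn0⟩ with hi'
      have hne : i ≠ i' := fun h => hS (by rw [h])
      have hpos : (0 : ℝ) < y i' - s - p / 2 ^ m j := lt_of_lt_of_le (by positivity) hp1
      refine hlt hj2 (abs_sub_rat_ge_of_generic_difference (t := y i - y i') (p := p) ?_ r
        (hf i' hne r.den (le_trans (Finset.le_sup (Finset.mem_univ i'))
          ((le_max_right _ _).trans hr)) r.den_pos j) hj1)
      rw [show y i - s - (y i - y i') = y i' - s by ring, abs_of_pos hpos]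
      exact hp2

/-! ### Lower bound for the dimension of the product. -/

theorem natCast_le_dimH_of_ae_mem {N : ℕ} {G : Set (Fin N → ℝ)} (hG : ∀ᵐ w, w ∈ G) :
    (N : ℝ≥0∞) ≤ dimH G := by
  have h0 : volume G ≠ 0 := fun h => by
    obtain ⟨w, hw, hw'⟩ := (hG.and (measure_eq_zero_iff_ae_notMem.1 h)).exists
    exact hw' hw
  have := le_dimH_of_hausdorffMeasure_ne_zero (d := (N : NNReal)) (s := G) (by
    have h := hausdorffMeasure_pi_real (ι := Fin N)
    rw [Fintype.card_fin] at h
    rw [NNReal.coe_natCast, h]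
    exact h0)
  exact_mod_cast this

theorem le_dimH_cartesianPower {N : ℕ} {A : Set ℝ}
    (h : ∀ᵐ w : Fin N → ℝ, ∃ s : ℝ, ∀ i : Fin (N + 1),
      (Fin.cons 0 w : Fin (N + 1) → ℝ) i - s ∈ A) :
    (N : ℝ≥0∞) ≤ dimH (cartesianPower (N + 1) A) := by
  let F : EuclideanSpace ℝ (Fin (N + 1)) →L[ℝ] (Fin N → ℝ) :=
    ContinuousLinearMap.pi fun i => EuclideanSpace.proj i.succ - EuclideanSpace.proj 0
  refine le_trans (natCast_le_dimH_of_ae_mem (G := F '' cartesianPower (N + 1) A) ?_)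
    (F.lipschitz.dimH_image_le _)
  filter_upwards [h] with w ⟨s, hs⟩
  refine ⟨WithLp.toLp 2 fun i => (Fin.cons 0 w : Fin (N + 1) → ℝ) i - s, hs, ?_⟩
  ext i
  simp [F]

theorem ae_exists_forall_sub_mem_exponentSet {N : ℕ} (hN : 1 ≤ N) {lam mu : ℝ} (hlam : 2 < lam)
    (hle : lam ≤ mu) (h1 : 1 + lam * 2 / (lam - 1) < mu)
    (h2 : N = 1 ∧ 2 + lam / (lam - 1) < mu ∨ 2 + lam * 2 / (lam - 1) < mu) :
    ∀ᵐ w : Fin N → ℝ, ∃ s : ℝ, ∀ i : Fin (N + 1),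
      (Fin.cons 0 w : Fin (N + 1) → ℝ) i - s ∈ exponentSet lam mu := by
  have hne : lam - 1 - 0 ≠ 0 := by linarith
  -- The strict inequalities at `δ = 0` persist for small positive `δ`.
  have c1 : ContinuousAt (fun δ : ℝ => 1 + lam * (2 + δ) / (lam - 1 - δ)) 0 := by
    fun_prop (disch := assumption)
  have c2 : ContinuousAt (fun δ : ℝ => 2 + δ + (1 + δ) * (lam / (lam - 1))) 0 := by fun_prop
  have c3 : ContinuousAt
      (fun δ : ℝ => 2 + δ + (1 + δ) * (lam * (2 + δ) / (lam - 1 - δ))) 0 := by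
    fun_prop (disch := assumption)
  have e1 := c1.tendsto.eventually_lt_const (u := mu) (by simpa using h1)
  have e2 : ∀ᶠ δ : ℝ in nhds 0, N = 1 ∧ 2 + δ + (1 + δ) * (lam / (lam - 1)) < mu ∨
      2 + δ + (1 + δ) * (lam * (2 + δ) / (lam - 1 - δ)) < mu := by
    rcases h2 with ⟨hN1, h2⟩ | h2
    · filter_upwards [c2.tendsto.eventually_lt_const (u := mu) (by simpa using h2)] with δ h
      exact Or.inl ⟨hN1, h⟩
    · filter_upwards [c3.tendsto.eventually_lt_const (u := mu) (by simpa using h2)] with δ h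
      exact Or.inr h
  obtain ⟨δ, ⟨⟨e1, e2⟩, e3⟩, hδ⟩ := ((((e1.and e2).and
    (eventually_lt_nhds (show (0 : ℝ) < lam - 1 by linarith))).filter_mono
      nhdsWithin_le_nhds).and (self_mem_nhdsWithin (a := (0 : ℝ)) (s := Set.Ioi 0))).exists
  obtain ⟨m, hm⟩ := exists_scale_sequence (lam := lam) (by linarith)
  have hgen := ae_forall_abs_sub_fraction_ge hδ (fun k => 2 ^ m k) (fun k => Nat.one_le_two_pow)
    (tsum_two_pow_rpow_neg_ne_top hδ (le_scale_sequence (by linarith) fun k => (hm k).1))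
  let c : Fin (N + 1) → ((Fin N → ℝ) →ₗ[ℝ] ℝ) := Fin.cons 0 fun i => LinearMap.proj i
  have hc : ∀ i w, c i w = (Fin.cons 0 w : Fin (N + 1) → ℝ) i := by
    intro i w
    refine Fin.cases ?_ (fun i => ?_) i <;> simp [c]
  have hcne : ∀ i j, i ≠ j → c i - c j ≠ 0 := by
    have hinj : Function.Injective c := by
      intro i j hij
      -- The test vector `(1, 2, …, N)` has distinct nonzero entries, so it separates all the
      -- functionals, including zero.
      have := LinearMap.congr_fun hij fun k => (k : ℝ) + 1
      rw [hc, hc] at this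
      induction i using Fin.cases <;> induction j using Fin.cases
      · rfl
      · rw [Fin.cons_zero, Fin.cons_succ] at this
        exact absurd this (by positivity)
      · rw [Fin.cons_zero, Fin.cons_succ] at this
        exact absurd this (by positivity)
      · rw [Fin.cons_succ, Fin.cons_succ, add_left_inj, Nat.cast_inj] at this
        rw [Fin.ext this]
    exact fun i j hij => sub_ne_zero.2 (hinj.ne hij)
  have hall : ∀ᵐ w : Fin N → ℝ, ∀ i j, i ≠ j → ∃ q₀ : ℕ, ∀ q ≥ q₀, 1 ≤ q → ∀ (k : ℕ) (P : ℤ),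
      (q : ℝ) ^ (-(2 + δ)) * ((2 ^ m k : ℕ) : ℝ) ^ (-(1 + δ)) ≤
        |((Fin.cons 0 w : Fin (N + 1) → ℝ) i - (Fin.cons 0 w : Fin (N + 1) → ℝ) j)
          - P / (q * (2 ^ m k : ℕ))| := by
    refine ae_all_iff.2 fun i => ae_all_iff.2 fun j => ?_
    by_cases hij : i = j
    · exact Filter.Eventually.of_forall fun w h => absurd hij h
    · filter_upwards [ae_comp_linearMap volume _ (hcne i j hij) hgen] with w hw _
      simpa only [LinearMap.sub_apply, hc] using hw
  filter_upwards [hall] with w hw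
  refine exists_forall_sub_mem_exponentSet (by omega) hlam hle hδ e3 (fun k => (hm k).1)
    (fun k => (hm k).2) e1 ?_ _ hw
  rcases e2 with ⟨hN1, h⟩ | h
  · exact Or.inl ⟨by omega, h⟩
  · exact Or.inr h

theorem mainTheorem6 (n : ℕ) (hn : 2 ≤ n) (lam mu : ℝ) (hle : lam ≤ mu)
    (hlam : 2 * (n : ℝ) / ((n : ℝ) - 1) < lam)
    (hmu : (lam ^ (n - 1) + lam - 1) / (lam - 1) < mu) :
    (n : ℝ≥0∞) * dimH (exponentSet (lam : EReal) (mu : EReal)) <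
      dimH (cartesianPower n (exponentSet (lam : EReal) (mu : EReal))) := by
  obtain ⟨N, rfl⟩ : ∃ N, n = N + 1 := ⟨n - 1, by omega⟩
  have hN : 1 ≤ N := by omega
  have hN' : (1 : ℝ) ≤ N := by exact_mod_cast hN
  rw [Nat.add_sub_cancel] at hmu
  push_cast at hlam
  rw [add_sub_cancel_right, div_lt_iff₀ (by linarith)] at hlam
  have hlam2 : 2 < lam := by
    by_contra! h
    nlinarith
  have hl1 : 0 < lam - 1 := by linarith
  have hcond : 1 + lam * 2 / (lam - 1) < mu ∧
      (N = 1 ∧ 2 + lam / (lam - 1) < mu ∨ 2 + lam * 2 / (lam - 1) < mu) := by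
    -- For two factors `lam > 4` and `lam ≤ mu` suffice; for more, `3 * lam - 1 ≤ lam ^ N` turns
    -- `hmu` into the stronger condition.
    rcases hN.eq_or_lt with rfl | hN2
    · have h4 : 4 < lam := by norm_num at hlam; linarith
      have e1 : lam * 2 / (lam - 1) < 3 := by
        rw [div_lt_iff₀ hl1]; linarith
      have e2 : lam / (lam - 1) < 2 := by
        rw [div_lt_iff₀ hl1]; linarith
      exact ⟨by linarith, Or.inl ⟨rfl, by linarith⟩⟩
    · have hpow : 3 * lam - 1 ≤ lam ^ N := by
        rcases (Nat.succ_le_of_lt hN2).eq_or_lt with h | h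
        · rw [← h] at hlam ⊢
          norm_num at hlam ⊢
          nlinarith
        · calc 3 * lam - 1 ≤ lam ^ 3 := by nlinarith [sq_nonneg (lam - 2)]
            _ ≤ lam ^ N := pow_le_pow_right₀ (by linarith) h
      have e1 : 2 + lam * 2 / (lam - 1) < mu := by
        refine lt_of_le_of_lt ?_ hmu
        rw [← sub_nonneg]
        have : (lam ^ N + lam - 1) / (lam - 1) - (2 + lam * 2 / (lam - 1)) =
            (lam ^ N - (3 * lam - 1)) / (lam - 1) := by
          field_simp
          ring
        rw [this]
        exact div_nonneg (by linarith) hl1.le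
      exact ⟨by linarith, Or.inr e1⟩
  refine lt_of_lt_of_le ?_ (le_dimH_cartesianPower
    (ae_exists_forall_sub_mem_exponentSet hN hlam2 hle hcond.1 hcond.2))
  calc ((N + 1 : ℕ) : ℝ≥0∞) * dimH (exponentSet (lam : EReal) (mu : EReal))
      ≤ ((N + 1 : ℕ) : ℝ≥0∞) * ENNReal.ofReal (2 / lam) := by
        gcongr
        exact dimH_exponentSet_le (by linarith) _
    _ = ENNReal.ofReal (2 * (N + 1) / lam) := by
        rw [← ENNReal.ofReal_natCast, ← ENNReal.ofReal_mul (by positivity)]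
        congr 1
        push_cast
        ring
    _ < ENNReal.ofReal N := by
        rw [ENNReal.ofReal_lt_ofReal_iff (by linarith), div_lt_iff₀ (by linarith)]
        linarith
    _ = N := ENNReal.ofReal_natCast N
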